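/- Let $1\le p\le q$ be integers, $r=\tfrac12(q-p+1)$, $h=\tfrac12(q+p-1)$, $\alpha\in\mathbb R$, and let $\mu_1\ge\dots\ge\mu_p\ge 0$ be integers. On the matrix ball of complex $p\times q$ matrices $z$ with $zz^*<1$, let $$\Delta_\mu(z)=S_\mu(zz^*)\det(1-zz^*)^{\alpha},$$ where $S_\mu(A)$ is the Schur function $\det\{y_k^{\mu_l+p-l}\}/\prod_{k<l}(y_k-y_l)$ of the eigenvalues $y_1,\dots,y_p$ of $A$ (extended by continuity to coinciding eigenvalues). A function $f$ on the ball which is invariant under $\mathrm U(p)\times \mathrm U(q)$ is regarded as a symmetric function $f(x)$ of $x_1,\dots,x_p\ge 0$, where $x_k/(1+x_k)$ are the eigenvalues of $zz^*$. For $s\in\mathbb C^p$ with $s_k^2\ne s_l^2$ $(k\neq l)$ let $$\Phi_s(x)=\prod_{n=0}^{p-1}n!\,(q-p+1)_n\cdot\frac{\det_{k,j}\bigl\{{}_2F_1(r+s_j,r-s_j;2r;-x_k)\bigr\}}{\prod_{k<l}(s_k^2-s_l^2)\prod_{k<l}(x_k-x_l)}$$ be the spherical function of $\mathrm U(p,q)$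 (normalized by $\Phi_s(0)=1$; ${}_2F_1$ is continued analytically to the negative half-axis), and let the spherical transform be $$\widehat f(s)=\kappa\int_{x_1,\dots,x_p\ge 0}f(x)\,\Phi_s(x)\prod_{j}x_j^{q-p}\prod_{k<l}(x_k-x_l)^2\,dx_1\cdots dx_p ,$$ where $\kappa$ is an arbitrary normalizing constant. Write $(a)_n=a(a+1)\cdots(a+n-1)$ and let $$\mathcal S_n(t^2;a,b,c)=(a+b)_n(a+c)_n\;{}_3F_2\Bigl[{-n,\;a+it,\;a-it\atop a+b,\;a+c};1\Bigr]$$ be the continuous dual Hahn polynomials. **Theorem.** If $|\operatorname{Re}s_k|<\alpha-h$ for all $k$ and the $s_k^2$ are pairwise distinct, then the integral defining $\widehat{\Delta_\mu}(s)$ converges absolutely and $$\widehat{\Delta_\mu}(s)=C\cdot\frac{\prod_{k=1}^p\Gamma(\alpha-h+s_k)\Gamma(\alpha-h-s_k)}{\prod_{j=0}^{p-1}\Gamma(\alpha-j)^2}\cdot\frac{\det_{k,l}\bigl\{\mathcal S_{\mu_l+p-l}(-s_k^2;\alpha-h,r,r)\bigr\}}{\prod_{k<l}(s_k^2-s_l^2)},$$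 where the constant $C$, independent of $s$, is $$C=\kappa\;p!\,\prod_{j=0}^{p-1}j!\,(q-p+j)!\;\prod_{j=1}^{p}\frac1{\bigl((\alpha-j+1)_{\mu_j}\bigr)^{2}} .$$ -/

import Mathlib

open MeasureTheory Set Filter Topology

noncomputable section

/-- The rising factorial `(a)_n = a (a + 1) ⋯ (a + n - 1)`. -/
def poch (a : ℂ) (n : ℕ) : ℂ := (ascPochhammer ℂ n).eval a

/-- `F` is the holomorphic continuation of the Gauss series `₂F₁(a, b; c; z)` from a neighbourhood
of `0` to the half-plane `Re z < 1 / 2`, which contains the closed negative half-axis. Such an `F`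
is unique on that half-plane, by the identity theorem. -/
def IsGaussContinuation (a b c : ℂ) (F : ℂ → ℂ) : Prop :=
  DifferentiableOn ℂ F {z : ℂ | z.re < 1 / 2} ∧ F =ᶠ[𝓝 0] ordinaryHypergeometric a b c

/-- The Gauss hypergeometric function `₂F₁(a, b; c; z)` for `Re z < 1 / 2`, in the usual sense of
analytic continuation (the series itself converges only for `|z| < 1`). -/
def gauss2F1 (a b c : ℂ) : ℂ → ℂ := Classical.epsilon (IsGaussContinuation a b c)

/-- The series `₃F₂(a, b, c; d, e; x)`. -/
def hyper3F2 (a b c d e x : ℂ) : ℂ :=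
  ∑' n : ℕ, poch a n * poch b n * poch c n * x ^ n / (n.factorial * poch d n * poch e n)

/-- The continuous dual Hahn polynomial `𝒮_n(s²; a, b, c)`, as a function of `s`:
`(a + b)_n (a + c)_n ₃F₂(-n, a + i s, a - i s; a + b, a + c; 1)`. -/
def dualHahn (n : ℕ) (s a b c : ℂ) : ℂ :=
  poch (a + b) n * poch (a + c) n *
    hyper3F2 (-n) (a + Complex.I * s) (a - Complex.I * s) (a + b) (a + c) 1

/-- The difference product `∏_{k < l} (y_k - y_l)`. -/
def diffProd {R : Type*} [CommRing R] {p : ℕ} (y : Fin p → R) : R :=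
  ∏ k : Fin p, ∏ l ∈ Finset.Ioi k, (y k - y l)

/-- The Schur function `s_μ(y) = det (y_k ^ (μ_l + p - l)) / ∏_{k < l} (y_k - y_l)`, extended by
continuity to points with coinciding coordinates. With rows and columns numbered from `0`, the
exponent `μ_l + p - l` reads `μ l + (p - 1 - l)`. -/
def schurFun {p : ℕ} (μ : Fin p → ℕ) : (Fin p → ℝ) → ℝ :=
  extendFrom {y | Function.Injective y} fun y =>
    (Matrix.of fun k l : Fin p => y k ^ (μ l + (p - 1 - (l : ℕ)))).det / diffProd y

/-- The canonical basis element `Δ_μ(z) = S_μ(z z*) det(1 - z z*)^α`, a function on the matrix ball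
`z z* < 1`; here `S_μ(A)` is the Schur function of the eigenvalues of `A`. -/
def canonicalBasis {p q : ℕ} (α : ℝ) (μ : Fin p → ℕ) (z : Matrix (Fin p) (Fin q) ℂ) : ℂ :=
  ((schurFun μ (Matrix.isHermitian_mul_conjTranspose_self z).eigenvalues *
    (1 - z * z.conjTranspose).det.re ^ α : ℝ) : ℂ)

/-- The point of the matrix ball with radial coordinates `x_k = λ_k² / (1 - λ_k²) ≥ 0`: the `p × q`
matrix with diagonal entries `λ_k = √(x_k / (1 + x_k))` and zeros elsewhere. Every
`U(p) × U(q)`-orbit in the ball contains such a point, unique up to permuting the `x_k`. -/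
def radialPoint {p : ℕ} (q : ℕ) (x : Fin p → ℝ) : Matrix (Fin p) (Fin q) ℂ :=
  Matrix.of fun i j => if (j : ℕ) = (i : ℕ) then ((√(x i / (1 + x i)) : ℝ) : ℂ) else 0

/-- The density `w(x) = ∏ x_j ^ (q - p) ∏_{k < l} (x_k - x_l)²`, for `p ≤ q`. -/
def radialWeight {p : ℕ} (q : ℕ) (x : Fin p → ℝ) : ℝ :=
  (∏ j, x j ^ (q - p)) * diffProd x ^ 2

/-- The spherical function `Φ_s(x)` of `U(p, q)`, `p ≤ q`, given by the Berezin–Karpelevich formula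
at points where the `x_k` are distinct and the `s_k²` are distinct. The constant
`∏_{n < p} n! (q - p + 1)_n` is the one for which `Φ_s → 1` as `x → 0`. -/
def sphericalFun {p : ℕ} (q : ℕ) (s : Fin p → ℂ) (x : Fin p → ℝ) : ℂ :=
  (∏ n ∈ Finset.range p, (n.factorial : ℂ) * poch (q - p + 1) n) *
    (Matrix.of fun k j : Fin p =>
      gauss2F1 ((q - p + 1) / 2 + s j) ((q - p + 1) / 2 - s j) (q - p + 1) (-(x k : ℂ))).det /
    (diffProd (fun k => s k ^ 2) * diffProd (fun k => (x k : ℂ)))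

/-- The integrand `f(x) Φ_s(x) w(x)` of the spherical transform, for a function `f` on the matrix
ball that is invariant under `U(p) × U(q)`, written in radial coordinates. -/
def sphericalIntegrand {p q : ℕ} (f : Matrix (Fin p) (Fin q) ℂ → ℂ) (s : Fin p → ℂ)
    (x : Fin p → ℝ) : ℂ :=
  f (radialPoint q x) * sphericalFun q s x * (radialWeight q x : ℂ)

/-- The spherical transform `F(s) = κ ∫ f(x) Φ_s(x) w(x) dx` over `x_1, …, x_p ≥ 0`, where the
constant `κ` is the choice of normalization. -/
def sphericalTransform {p q : ℕ} (κ : ℂ) (f : Matrix (Fin p) (Fin q) ℂ → ℂ) (s : Fin p → ℂ) : ℂ :=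
  κ * ∫ x in Ici (0 : Fin p → ℝ), sphericalIntegrand f s x

end

/-! With y = x/(1+x) one has y_k - y_l = (x_k - x_l)/((1+x_k)(1+x_l)). The denominators of the Schur
function and of Φ_s therefore cancel the squared Vandermonde in the weight, and the integrand
becomes a product of two determinants with one-variable entries
(`sphericalIntegrand_canonicalBasis`). Andréief's identity (`integral_det_mul_det`) turns the
integral into p! times a determinant of integrals over x > 0 of (x/(1+x))^m x^(q-p) (1+x)^(-β)
₂F₁(r+s, r-s; 2r; -x), where β = α-p+1 = (α-h)+r.

For m = 0, put a = r+s, b = r-s, so that 2r - b = a. Pfaff's transformation gives a series in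
x/(1+x) that integrates termwise to a Gauss series ₂F₁(a, a; β+a; 1), and its sum yields
Γ(2r)Γ(β-a)Γ(β-b)/Γ(β)² (`integral_gauss2F1`). For general m, expanding (1 - 1/(1+x))^m shifts β to
β+k. The Gamma quotients become rising factorials, and the sum over k is the terminating ₃F₂ of a
continuous dual Hahn polynomial (`integral_schurColumn_mul_gauss2F1`). -/

/-! ### Rising factorials. -/

theorem poch_zero (a : ℂ) : poch a 0 = 1 := by simp [poch]

theorem poch_succ (a : ℂ) (n : ℕ) : poch a (n + 1) = poch a n * (a + n) := by
  simp [poch, ascPochhammer_succ_eval]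

theorem poch_eq_prod (a : ℂ) (n : ℕ) : poch a n = ∏ j ∈ Finset.range n, (a + j) := by
  induction n with
  | zero => simp [poch_zero]
  | succ n ih => rw [poch_succ, ih, Finset.prod_range_succ]

theorem poch_add (a : ℂ) (n k : ℕ) : poch a (n + k) = poch a n * poch (a + n) k := by
  simp only [poch_eq_prod, Finset.prod_range_add]
  congr 1
  exact Finset.prod_congr rfl fun j _ => by push_cast; ring

theorem ne_neg_natCast_of_re_pos {a : ℂ} (ha : 0 < a.re) (k : ℕ) : a ≠ -k := by
  rintro rfl
  simp only [Complex.neg_re, Complex.natCast_re, Left.neg_pos_iff] at ha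
  exact absurd ha (not_lt.2 k.cast_nonneg)

theorem Gamma_add_natCast {a : ℂ} (ha : 0 < a.re) (n : ℕ) :
    Complex.Gamma (a + n) = Complex.Gamma a * poch a n := by
  rw [poch, ← Complex.Gamma_add_nat_div_Gamma_eq a (ne_neg_natCast_of_re_pos ha),
    mul_div_cancel₀ _ (Complex.Gamma_ne_zero_of_re_pos ha)]

theorem poch_ne_zero {a : ℂ} (ha : 0 < a.re) (n : ℕ) : poch a n ≠ 0 := by
  rw [poch_eq_prod, Finset.prod_ne_zero_iff]
  intro j _ h
  exact ne_neg_natCast_of_re_pos ha j (by linear_combination h)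

theorem norm_poch_ofReal {a : ℝ} (ha : 0 < a) (n : ℕ) : ((‖poch a n‖ : ℝ) : ℂ) = poch a n := by
  have h : poch a n = ((∏ j ∈ Finset.range n, (a + j) : ℝ) : ℂ) := by
    rw [poch_eq_prod]; push_cast; rfl
  rw [h, Complex.norm_real, Real.norm_of_nonneg (Finset.prod_nonneg fun j _ => by positivity)]

/-- `(a)_{n+1} / (n ^ a n!) → 1 / Γ(a)`. -/
theorem tendsto_poch_succ_div {a : ℂ} (ha : 0 < a.re) :
    Tendsto (fun n : ℕ => poch a (n + 1) / ((n : ℂ) ^ a * n.factorial)) atTop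
      (𝓝 (Complex.Gamma a)⁻¹) := by
  refine ((Complex.GammaSeq_tendsto_Gamma a).inv₀
    (Complex.Gamma_ne_zero_of_re_pos ha)).congr fun n => ?_
  rw [Complex.GammaSeq, inv_div, poch_eq_prod]

/-! ### Beta integrals and Gauss's summation theorem. -/

/-- By Euler's limit for Γ, the terms are O(n^(Re(a+b-c)-1)). -/
theorem summable_poch_mul_poch_div {a b c : ℂ} (ha : 0 < a.re) (hb : 0 < b.re)
    (hc : a.re + b.re < c.re) :
    Summable fun n : ℕ => ‖poch a n * poch b n / (n.factorial * poch c n)‖ := by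
  have hc0 : 0 < c.re := by linarith
  rw [← summable_nat_add_iff 1]
  have hlim := ((tendsto_poch_succ_div ha).mul (tendsto_poch_succ_div hb)).mul
    ((tendsto_poch_succ_div hc0).inv₀ (inv_ne_zero (Complex.Gamma_ne_zero_of_re_pos hc0)))
  refine summable_of_isBigO_nat
    (Real.summable_nat_rpow.mpr (show a.re + b.re - c.re - 1 < -1 by linarith)) ?_
  refine Asymptotics.IsBigO.trans ?_ (Asymptotics.IsBigO.trans
    (hlim.norm.isBigO_one ℝ |>.mul (Asymptotics.isBigO_refl
      (fun n : ℕ => (n : ℝ) ^ (a.re + b.re - c.re - 1)) atTop)) ?_)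
  · refine Asymptotics.IsBigO.of_bound 1 ?_
    filter_upwards [eventually_ge_atTop 1] with n hn
    have hn0 : (0 : ℝ) < n := by exact_mod_cast hn
    have hf : (0 : ℝ) < n.factorial := by exact_mod_cast n.factorial_pos
    have hpc : 0 < ‖poch c (n + 1)‖ := norm_pos_iff.2 (poch_ne_zero hc0 _)
    simp only [norm_mul, norm_div, norm_inv, norm_norm, Complex.norm_natCast,
      Complex.norm_natCast_cpow_of_pos hn, one_mul]
    rw [Real.norm_of_nonneg (by positivity : (0 : ℝ) ≤ (n : ℝ) ^ (a.re + b.re - c.re - 1)),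
      Real.rpow_sub_one hn0.ne', Real.rpow_sub hn0, Real.rpow_add hn0, Nat.factorial_succ]
    push_cast
    have h1 : (0 : ℝ) < (n : ℝ) ^ a.re := by positivity
    have h2 : (0 : ℝ) < (n : ℝ) ^ b.re := by positivity
    have h3 : (0 : ℝ) < (n : ℝ) ^ c.re := by positivity
    have key : ‖poch a (n + 1)‖ / (↑n ^ a.re * ↑n.factorial) *
        (‖poch b (n + 1)‖ / (↑n ^ b.re * ↑n.factorial)) *
        (‖poch c (n + 1)‖ / (↑n ^ c.re * ↑n.factorial))⁻¹ *
        (↑n ^ a.re * ↑n ^ b.re / ↑n ^ c.re / ↑n) =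
        ‖poch a (n + 1)‖ * ‖poch b (n + 1)‖ / (n * n.factorial * ‖poch c (n + 1)‖) := by
      field_simp
    have h4 : (0 : ℝ) < n + 1 := by positivity
    simp only [Real.norm_eq_abs, abs_mul, abs_of_pos h1, abs_of_pos h2, abs_of_pos h3,
      abs_of_pos hf, abs_of_pos h4]
    rw [key]
    gcongr
    linarith
  · simpa using Asymptotics.isBigO_refl _ _

/-- The beta integral on the half-line. -/
theorem integral_pow_mul_one_add_cpow (n : ℕ) : ∀ w : ℂ, (n : ℝ) + 1 < w.re →
    IntegrableOn (fun x : ℝ => (x : ℂ) ^ n * (1 + x : ℂ) ^ (-w)) (Ioi 0) ∧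
    ∫ x in Ioi (0 : ℝ), (x : ℂ) ^ n * (1 + x : ℂ) ^ (-w) =
      n.factorial * Complex.Gamma (w - n - 1) / Complex.Gamma w := by
  have hpos : ∀ x ∈ Ioi (0 : ℝ), (1 + x : ℂ) ≠ 0 := fun x hx => by
    have : (0 : ℝ) < 1 + x := by linarith [mem_Ioi.1 hx]
    exact_mod_cast this.ne'
  induction n with
  | zero =>
    intro w hw
    have hw1 : 1 < w.re := by simpa using hw
    have hw0 : w - 1 ≠ 0 := fun h => by
      have := congrArg Complex.re h
      simp at this; linarith
    have hint : IntegrableOn (fun x : ℝ => (1 + x : ℂ) ^ (-w)) (Ioi 0) := by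
      have h1 := integrableOn_add_rpow_Ioi_of_lt (a := -w.re) (c := 0) (m := 1) (by linarith)
        (by norm_num)
      refine Integrable.mono' h1 ?_ ?_
      · refine ContinuousOn.aestronglyMeasurable (fun x hx => ?_) measurableSet_Ioi
        refine ContinuousAt.continuousWithinAt ?_
        refine ContinuousAt.cpow (by fun_prop) continuousAt_const (Or.inl ?_)
        simp; linarith [mem_Ioi.1 hx]
      · refine (ae_restrict_iff' measurableSet_Ioi).2 (Eventually.of_forall fun x hx => ?_)
        have : (0 : ℝ) < 1 + x := by linarith [mem_Ioi.1 hx]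
        rw [show (1 + x : ℂ) = ((1 + x : ℝ) : ℂ) by push_cast; rfl,
          Complex.norm_cpow_eq_rpow_re_of_pos this, add_comm 1 x]
        simp
    refine ⟨by simpa using hint, ?_⟩
    have hderiv : ∀ x ∈ Ici (0 : ℝ),
        HasDerivAt (fun y : ℝ => -(1 + y : ℂ) ^ (1 - w) / (w - 1)) ((1 + x : ℂ) ^ (-w)) x := by
      intro x hx
      have h1 : HasDerivAt (fun y : ℂ => 1 + y) 1 (x : ℂ) := (hasDerivAt_id _).const_add 1
      have hm : (1 + x : ℂ) ∈ Complex.slitPlane := Or.inl (by simp; linarith [mem_Ici.1 hx])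
      have h2 := (((h1.cpow_const (c := 1 - w) hm).neg).div_const (w - 1)).comp_ofReal
      convert! h2 using 1
      rw [show 1 - w - 1 = -w by ring]
      field_simp
      ring
    have hlim : Tendsto (fun y : ℝ => -(1 + y : ℂ) ^ (1 - w) / (w - 1)) atTop (𝓝 0) := by
      have h1 : Tendsto (fun y : ℝ => (1 + y : ℂ) ^ (1 - w)) atTop (𝓝 0) := by
        rw [tendsto_zero_iff_norm_tendsto_zero]
        have h2 := (tendsto_rpow_neg_atTop (show 0 < w.re - 1 by linarith)).comp
          (tendsto_atTop_add_const_left atTop (1 : ℝ) tendsto_id)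
        refine h2.congr' ?_
        filter_upwards [eventually_gt_atTop 0] with y hy
        have : (0 : ℝ) < 1 + y := by linarith
        rw [show (1 + y : ℂ) = ((1 + y : ℝ) : ℂ) by push_cast; rfl,
          Complex.norm_cpow_eq_rpow_re_of_pos this]
        simp
      simpa using (h1.neg.div_const (w - 1))
    have := integral_Ioi_of_hasDerivAt_of_tendsto' hderiv hint hlim
    simp only [pow_zero, one_mul, this]
    have hG : Complex.Gamma w = (w - 1) * Complex.Gamma (w - 1) := by
      conv_lhs => rw [show w = (w - 1) + 1 by ring]
      exact Complex.Gamma_add_one _ hw0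
    have hG0 : Complex.Gamma (w - 1) ≠ 0 :=
      Complex.Gamma_ne_zero_of_re_pos (by simp; linarith)
    rw [hG]
    simp
    field_simp
  | succ n ih =>
    intro w hw
    push_cast at hw
    -- Writing one factor x as (1+x) - 1 lowers the power of x, at the exponents w-1 and w.
    obtain ⟨i1, e1⟩ := ih (w - 1) (by simp; linarith)
    obtain ⟨i2, e2⟩ := ih w (by linarith)
    have hfun : EqOn (fun x : ℝ => (x : ℂ) ^ (n + 1) * (1 + x : ℂ) ^ (-w))
        (fun x : ℝ => (x : ℂ) ^ n * (1 + x : ℂ) ^ (-(w - 1)) -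
          (x : ℂ) ^ n * (1 + x : ℂ) ^ (-w)) (Ioi 0) := by
      intro x hx
      simp only
      rw [show -(w - 1) = -w + 1 by ring, Complex.cpow_add _ _ (hpos x hx), Complex.cpow_one]
      ring
    refine ⟨(i1.sub i2).congr_fun hfun.symm measurableSet_Ioi, ?_⟩
    rw [setIntegral_congr_fun measurableSet_Ioi hfun, integral_sub i1 i2, e1, e2]
    have hn : (0 : ℝ) ≤ n := n.cast_nonneg
    have hw1 : w - 1 ≠ 0 := fun h => by
      have := congrArg Complex.re h
      simp at this; linarith
    have hw2 : w - n - 2 ≠ 0 := fun h => by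
      have := congrArg Complex.re h
      simp at this; linarith
    have hG : Complex.Gamma w = (w - 1) * Complex.Gamma (w - 1) := by
      conv_lhs => rw [show w = (w - 1) + 1 by ring]
      exact Complex.Gamma_add_one _ hw1
    have hG' : Complex.Gamma (w - n - 1) = (w - n - 2) * Complex.Gamma (w - n - 2) := by
      conv_lhs => rw [show w - n - 1 = (w - n - 2) + 1 by ring]
      exact Complex.Gamma_add_one _ hw2
    have hG0 : Complex.Gamma (w - 1) ≠ 0 :=
      Complex.Gamma_ne_zero_of_re_pos (by simp; linarith)
    rw [hG, hG', show w - 1 - n - 1 = w - n - 2 by ring, Nat.factorial_succ,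
      show w - ((n + 1 : ℕ) : ℂ) - 1 = w - n - 2 by push_cast; ring]
    push_cast
    field_simp
    ring

/-- Taking norms replaces w by Re w, so this is the same beta integral; it serves to justify
termwise integration. -/
theorem integral_norm_pow_mul_one_add_cpow (n : ℕ) (w : ℂ) (hw : (n : ℝ) + 1 < w.re) :
    ∫ x in Ioi (0 : ℝ), ‖(x : ℂ) ^ n * (1 + x : ℂ) ^ (-w)‖ =
      ‖n.factorial * Complex.Gamma (w.re - n - 1) / Complex.Gamma w.re‖ := by
  have h := (integral_pow_mul_one_add_cpow n (w.re : ℂ) (by simpa using hw)).2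
  have h2 : ∫ x in Ioi (0 : ℝ), (x : ℂ) ^ n * (1 + x : ℂ) ^ (-(w.re : ℂ)) =
      ((∫ x in Ioi (0 : ℝ), ‖(x : ℂ) ^ n * (1 + x : ℂ) ^ (-w)‖ : ℝ) : ℂ) := by
    rw [← integral_complex_ofReal]
    refine setIntegral_congr_fun measurableSet_Ioi fun x hx => ?_
    have h0 : (0 : ℝ) < x := hx
    have h1 : (0 : ℝ) < 1 + x := by linarith
    rw [show (1 + x : ℂ) = ((1 + x : ℝ) : ℂ) by push_cast; rfl, norm_mul,
      Complex.norm_cpow_eq_rpow_re_of_pos h1, norm_pow, Complex.norm_real,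
      Real.norm_of_nonneg h0.le]
    push_cast
    rw [← Complex.ofReal_one, ← Complex.ofReal_add, ← Complex.ofReal_neg,
      ← Complex.ofReal_cpow h1.le]
    simp
  rw [← h, h2, Complex.norm_real, Real.norm_of_nonneg (integral_nonneg fun x => norm_nonneg _)]

theorem hasSum_one_sub_cpow_neg (a : ℂ) {z : ℂ} (hz : ‖z‖ < 1) :
    HasSum (fun k : ℕ => poch a k / k.factorial * z ^ k) ((1 - z) ^ (-a)) := by
  have h := (Complex.one_div_one_sub_cpow_hasFPowerSeriesOnBall_zero a).hasSum (y := z)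
    (by simpa [← ENNReal.ofReal_one, Metric.eball_ofReal] using hz)
  simp only [zero_add, one_div, ← Complex.cpow_neg] at h
  refine h.congr_fun fun k => ?_
  rw [FormalMultilinearSeries.ofScalars_apply_eq, Ring.choose_eq_smul,
    Polynomial.descPochhammer_smeval_eq_ascPochhammer, Polynomial.ascPochhammer_smeval_cast,
    Polynomial.ascPochhammer_smeval_eq_eval, show a + k - 1 - k + 1 = a by ring, poch]
  simp only [smul_eq_mul]
  ring

theorem integral_beta_Ioo {u v : ℂ} (hu : 0 < u.re) (hv : 0 < v.re) :
    IntegrableOn (fun x : ℝ => (x : ℂ) ^ (u - 1) * (1 - x : ℂ) ^ (v - 1)) (Ioo 0 1) ∧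
    ∫ x in Ioo (0 : ℝ) 1, (x : ℂ) ^ (u - 1) * (1 - x : ℂ) ^ (v - 1) =
      Complex.Gamma u * Complex.Gamma v / Complex.Gamma (u + v) := by
  constructor
  · have := Complex.betaIntegral_convergent hu hv
    rw [intervalIntegrable_iff_integrableOn_Ioc_of_le zero_le_one] at this
    exact this.mono_set Ioo_subset_Ioc_self
  · rw [← Complex.betaIntegral_eq_Gamma_mul_div u v hu hv, Complex.betaIntegral,
      intervalIntegral.integral_of_le zero_le_one, integral_Ioc_eq_integral_Ioo]

theorem integral_norm_beta_Ioo {u v : ℂ} (hu : 0 < u.re) (hv : 0 < v.re) :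
    ∫ x in Ioo (0 : ℝ) 1, ‖(x : ℂ) ^ (u - 1) * (1 - x : ℂ) ^ (v - 1)‖ =
      ‖Complex.Gamma u.re * Complex.Gamma v.re / Complex.Gamma (u.re + v.re)‖ := by
  have h := (integral_beta_Ioo (u := (u.re : ℂ)) (v := (v.re : ℂ)) (by simpa) (by simpa)).2
  have h2 : ∫ x in Ioo (0 : ℝ) 1, (x : ℂ) ^ ((u.re : ℂ) - 1) * (1 - x : ℂ) ^ ((v.re : ℂ) - 1) =
      ((∫ x in Ioo (0 : ℝ) 1, ‖(x : ℂ) ^ (u - 1) * (1 - x : ℂ) ^ (v - 1)‖ : ℝ) : ℂ) := by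
    rw [← integral_complex_ofReal]
    refine setIntegral_congr_fun measurableSet_Ioo fun x hx => ?_
    have h1 : (0 : ℝ) < 1 - x := by linarith [hx.2]
    rw [show (1 - x : ℂ) = ((1 - x : ℝ) : ℂ) by push_cast; rfl, norm_mul,
      Complex.norm_cpow_eq_rpow_re_of_pos h1, Complex.norm_cpow_eq_rpow_re_of_pos hx.1]
    push_cast
    rw [← Complex.ofReal_one, ← Complex.ofReal_sub, ← Complex.ofReal_sub, ← Complex.ofReal_sub,
      ← Complex.ofReal_cpow h1.le, ← Complex.ofReal_cpow hx.1.le]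
    simp
  rw [← h, h2, Complex.norm_real, Real.norm_of_nonneg (integral_nonneg fun x => norm_nonneg _)]

/-- **Gauss's summation theorem**, for parameters with positive real part. -/
theorem hasSum_gauss {a b c : ℂ} (ha : 0 < a.re) (hb : 0 < b.re) (hc : a.re + b.re < c.re) :
    HasSum (fun n : ℕ => poch a n * poch b n / (n.factorial * poch c n))
      (Complex.Gamma c * Complex.Gamma (c - a - b) /
        (Complex.Gamma (c - a) * Complex.Gamma (c - b))) := by
  have hc0 : 0 < c.re := by linarith
  have hca : 0 < (c - a).re := by simp; linarith
  have hcb : 0 < (c - b).re := by simp; linarith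
  have hcab : 0 < (c - a - b).re := by simp; linarith
  have han (n : ℕ) : 0 < (a + n).re := by
    simp only [Complex.add_re, Complex.natCast_re]; positivity
  -- Euler's integral at argument 1: the factor (1-x)^(-b) is expanded against x^(a-1)
  -- (1-x)^(c-a-1).
  set F : ℕ → ℝ → ℂ := fun n x =>
    poch b n / n.factorial * ((x : ℂ) ^ (a + n - 1) * (1 - x : ℂ) ^ (c - a - 1)) with hF
  have hFint (n : ℕ) : IntegrableOn (F n) (Ioo 0 1) :=
    (integral_beta_Ioo (han n) hca).1.const_mul _
  have hFval (n : ℕ) : ∫ x in Ioo (0 : ℝ) 1, F n x =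
      Complex.Gamma a * Complex.Gamma (c - a) / Complex.Gamma c *
        (poch a n * poch b n / (n.factorial * poch c n)) := by
    rw [hF, integral_const_mul, (integral_beta_Ioo (han n) hca).2,
      show a + n + (c - a) = c + n by ring, Gamma_add_natCast ha, Gamma_add_natCast hc0]
    have := Complex.Gamma_ne_zero_of_re_pos hc0
    have := poch_ne_zero hc0 n
    have : (n.factorial : ℂ) ≠ 0 := by exact_mod_cast n.factorial_ne_zero
    field_simp
  -- The norms give the same kind of series with a, c replaced by their real parts.
  have hsum : Summable fun n => ∫ x in Ioo (0 : ℝ) 1, ‖F n x‖ := by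
    have h := (summable_poch_mul_poch_div (a := (a.re : ℂ)) (b := b) (c := (c.re : ℂ))
      (by simpa) hb (by simpa)).mul_left
      ‖Complex.Gamma a.re * Complex.Gamma (c - a).re / Complex.Gamma c.re‖
    refine h.congr fun n => ?_
    rw [hF]
    simp only [norm_mul (poch b n / n.factorial)]
    rw [integral_const_mul, integral_norm_beta_Ioo (han n) hca, ← norm_mul, ← norm_mul,
      ← Complex.ofReal_add, show (a + n).re + (c - a).re = c.re + n by simp; ring,
      show (a + n).re = a.re + n by simp, Complex.ofReal_add, Complex.ofReal_add,
      Complex.ofReal_natCast, Gamma_add_natCast (by simpa), Gamma_add_natCast (by simpa)]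
    congr 1
    have : Complex.Gamma c.re ≠ 0 := Complex.Gamma_ne_zero_of_re_pos (by simpa)
    have : poch c.re n ≠ 0 := poch_ne_zero (by simpa) n
    have : (n.factorial : ℂ) ≠ 0 := by exact_mod_cast n.factorial_ne_zero
    field_simp
  have key := hasSum_integral_of_summable_integral_norm hFint hsum
  have hpt : ∫ x in Ioo (0 : ℝ) 1, ∑' n, F n x =
      Complex.Gamma a * Complex.Gamma (c - a - b) / Complex.Gamma (c - b) := by
    rw [show c - b = a + (c - a - b) by ring, ← (integral_beta_Ioo ha hcab).2]
    refine setIntegral_congr_fun measurableSet_Ioo fun x hx => ?_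
    have hx0 : (x : ℂ) ≠ 0 := by exact_mod_cast hx.1.ne'
    have hx1 : (1 - x : ℂ) ≠ 0 := by
      have : (1 - x : ℝ) ≠ 0 := by linarith [hx.2]
      exact_mod_cast this
    have h := (hasSum_one_sub_cpow_neg b (z := (x : ℂ))
      (by rw [Complex.norm_real, Real.norm_of_nonneg hx.1.le]; exact hx.2)).mul_left
      ((x : ℂ) ^ (a - 1) * (1 - x : ℂ) ^ (c - a - 1))
    rw [show c - a - b - 1 = (c - a - 1) + -b by ring, Complex.cpow_add _ _ hx1, ← mul_assoc,
      ← h.tsum_eq]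
    refine tsum_congr fun n => ?_
    rw [hF]
    simp only
    rw [show a + n - 1 = (a - 1) + n by ring, Complex.cpow_add _ _ hx0, Complex.cpow_natCast]
    ring
  rw [hpt] at key
  simp only [hFval] at key
  have g1 := Complex.Gamma_ne_zero_of_re_pos ha
  have g2 := Complex.Gamma_ne_zero_of_re_pos hca
  have g3 := Complex.Gamma_ne_zero_of_re_pos hc0
  have g4 := Complex.Gamma_ne_zero_of_re_pos hcb
  have := key.mul_left (Complex.Gamma c / (Complex.Gamma a * Complex.Gamma (c - a)))
  convert! this using 1
  · ext n
    field_simp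
  · field_simp

/-! ### Pfaff's transformation and the continuation of ₂F₁. -/

/-- Chu–Vandermonde for falling factorials, applied to the sum (-e) + (c+N-1). -/
theorem sum_antidiagonal_poch (c e : ℂ) (N : ℕ) :
    ∑ ij ∈ Finset.HasAntidiagonal.antidiagonal N,
      (N.choose ij.1 : ℂ) * ((-1) ^ ij.1 * poch e ij.1 * poch (c + ij.1) ij.2) =
      poch (c - e) N := by
  have hd (n : ℕ) (x : ℂ) : (descPochhammer ℤ n).smeval x = poch (x - n + 1) n := by
    rw [Polynomial.descPochhammer_smeval_eq_ascPochhammer, Polynomial.ascPochhammer_smeval_cast,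
      Polynomial.ascPochhammer_smeval_eq_eval, poch]
  have h := Ring.descPochhammer_smeval_add N (Commute.all (-e) (c + N - 1))
  rw [hd, show -e + (c + N - 1) - N + 1 = c - e by ring] at h
  rw [h]
  refine Finset.sum_congr rfl fun ij hij => ?_
  rw [Finset.HasAntidiagonal.mem_antidiagonal] at hij
  congr 2
  · have := ascPochhammer_eval_neg_eq_descPochhammer ℂ (-e) ij.1
    rw [neg_neg] at this
    rw [poch, this, ← mul_assoc, ← mul_pow, hd, poch, descPochhammer_eval_eq_ascPochhammer]
    simp
  · rw [hd, ← hij]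
    congr 1
    push_cast
    ring

/-- A parameter in {0, -1, -2, …} makes the series terminate (for c through the convention 1/0 = 0);
otherwise the radius is 1. -/
theorem one_le_radius_ordinaryHypergeometricSeries (a b c : ℂ) :
    1 ≤ (ordinaryHypergeometricSeries ℂ a b c).radius := by
  by_cases ha : ∃ k : ℕ, a = -k
  · obtain ⟨k, rfl⟩ := ha
    simp [ordinaryHypergeometric_radius_top_of_neg_nat₁]
  by_cases hb : ∃ k : ℕ, b = -k
  · obtain ⟨k, rfl⟩ := hb
    simp [ordinaryHypergeometric_radius_top_of_neg_nat₂]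
  by_cases hc : ∃ k : ℕ, c = -k
  · obtain ⟨k, rfl⟩ := hc
    simp [ordinaryHypergeometric_radius_top_of_neg_nat₃]
  · rw [ordinaryHypergeometricSeries_radius_eq_one]
    exact fun k => ⟨fun h => ha ⟨k, by simp [h]⟩, fun h => hb ⟨k, by simp [h]⟩,
      fun h => hc ⟨k, by simp [h]⟩⟩

theorem summable_norm_hypergeometric_term (a b c : ℂ) {ρ : ℝ} (h0 : 0 ≤ ρ) (h1 : ρ < 1) :
    Summable fun n : ℕ => ‖poch a n * poch b n / (n.factorial * poch c n)‖ * ρ ^ n := by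
  have h := (ordinaryHypergeometricSeries ℂ a b c).summable_norm_mul_pow (r := ⟨ρ, h0⟩)
    (lt_of_lt_of_le (ENNReal.coe_lt_one_iff.2 h1) (one_le_radius_ordinaryHypergeometricSeries a b c))
  refine h.congr fun n => ?_
  rw [ordinaryHypergeometricSeries, FormalMultilinearSeries.ofScalars_norm]
  simp only [poch]
  congr 2
  rw [div_eq_mul_inv, mul_inv]
  ring

theorem hasSum_ordinaryHypergeometric (a b c : ℂ) {z : ℂ} (hz : ‖z‖ < 1) :
    HasSum (fun n : ℕ => poch a n * poch b n / (n.factorial * poch c n) * z ^ n)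
      (ordinaryHypergeometric a b c z) := by
  have h : Summable (fun n : ℕ => poch a n * poch b n / (n.factorial * poch c n) * z ^ n) := by
    refine Summable.of_norm ?_
    simpa [norm_mul, norm_pow] using
      summable_norm_hypergeometric_term a b c (norm_nonneg z) hz
  convert! h.hasSum using 1
  rw [ordinaryHypergeometric_eq_tsum]
  refine tsum_congr fun n => ?_
  rw [smul_eq_mul, poch, poch, poch, div_eq_mul_inv, mul_inv]
  ring

theorem differentiableOn_ordinaryHypergeometric (a b c : ℂ) :
    DifferentiableOn ℂ (ordinaryHypergeometric a b c : ℂ → ℂ) (Metric.ball 0 1) := by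
  have h := ((ordinaryHypergeometricSeries ℂ a b c).hasFPowerSeriesOnBall
    (lt_of_lt_of_le one_pos (one_le_radius_ordinaryHypergeometricSeries a b c))).differentiableOn
  refine h.mono fun z hz => ?_
  have : z ∈ Metric.eball (0 : ℂ) 1 := by
    rw [← ENNReal.ofReal_one, Metric.eball_ofReal]; exact hz
  exact Metric.eball_subset_eball (one_le_radius_ordinaryHypergeometricSeries a b c) this

/-- Re z < 1/2 means that z is closer to 0 than to 1. Hence the series in Pfaff's formula converges
on this whole half-plane. -/
theorem norm_div_sub_one_lt_one {z : ℂ} (hz : z.re < 1 / 2) : ‖z / (z - 1)‖ < 1 := by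
  have h1 : z - 1 ≠ 0 := fun h => by
    have := congrArg Complex.re h
    simp at this; linarith
  rw [norm_div, div_lt_one (norm_pos_iff.2 h1)]
  refine lt_of_pow_lt_pow_left₀ 2 (norm_nonneg _) ?_
  rw [← Complex.normSq_eq_norm_sq, ← Complex.normSq_eq_norm_sq, Complex.normSq_apply,
    Complex.normSq_apply]
  simp
  nlinarith

/-- The right-hand side of **Pfaff's transformation** of `₂F₁(a, b; c; z)`. -/
noncomputable def pfaff2F1 (a b c z : ℂ) : ℂ :=
  (1 - z) ^ (-a) * ordinaryHypergeometric a (c - b) c (z / (z - 1))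

theorem differentiableOn_pfaff2F1 (a b c : ℂ) :
    DifferentiableOn ℂ (pfaff2F1 a b c) {z : ℂ | z.re < 1 / 2} := by
  refine DifferentiableOn.mul ?_ ?_
  · refine DifferentiableOn.cpow (by fun_prop) (by fun_prop) fun z hz => Or.inl ?_
    simp only [mem_ofPred_eq] at hz
    simp; linarith
  · refine (differentiableOn_ordinaryHypergeometric a (c - b) c).comp ?_ fun z hz => ?_
    · refine DifferentiableOn.div (by fun_prop) (by fun_prop) fun z hz h => ?_
      have := congrArg Complex.re h
      simp only [mem_ofPred_eq] at hz
      simp at this; linarith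
    · simpa using norm_div_sub_one_lt_one hz

theorem norm_poch_add_natCast_le (a : ℂ) (n k : ℕ) :
    ‖poch (a + n) k‖ ≤ ‖poch ((‖a‖ + n : ℝ) : ℂ) k‖ := by
  simp only [poch_eq_prod, norm_prod]
  refine Finset.prod_le_prod (fun _ _ => norm_nonneg _) fun j _ => ?_
  rw [← Complex.ofReal_natCast j, ← Complex.ofReal_add, Complex.norm_real,
    Real.norm_of_nonneg (by positivity)]
  calc ‖a + n + ((j : ℝ) : ℂ)‖ ≤ ‖a‖ + ‖(n : ℂ)‖ + ‖((j : ℝ) : ℂ)‖ := norm_add₃_le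
    _ = ‖a‖ + n + j := by simp

theorem hasSum_norm_poch_mul_pow {t ρ : ℝ} (ht : 0 ≤ t) (h0 : 0 ≤ ρ) (h1 : ρ < 1) :
    HasSum (fun k : ℕ => ‖poch (t : ℂ) k‖ / k.factorial * ρ ^ k) ((1 - ρ) ^ (-t)) := by
  have h := hasSum_one_sub_cpow_neg (t : ℂ) (z := (ρ : ℂ))
    (by rw [Complex.norm_real, Real.norm_of_nonneg h0]; exact h1)
  have hpos : 0 ≤ 1 - ρ := by linarith
  rw [← Complex.ofReal_one, ← Complex.ofReal_sub, ← Complex.ofReal_neg,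
    ← Complex.ofReal_cpow hpos] at h
  rw [← Complex.hasSum_ofReal]
  refine h.congr_fun fun k => ?_
  have hk : ((‖poch (t : ℂ) k‖ : ℝ) : ℂ) = poch t k := by
    rcases eq_or_lt_of_le ht with rfl | h0
    · rcases k with _ | k
      · simp [poch_zero]
      · simp [poch_eq_prod, Finset.prod_range_succ']
    · exact norm_poch_ofReal h0 k
  push_cast
  rw [hk]

/-- Summing majorants over the second index gives (1-|z|)^(-|a|-n), which leaves a hypergeometric
series at |z|/(1-|z|) < 1. Any radius up to 1/2 would serve. -/
theorem summable_pfaff (a e c : ℂ) {z : ℂ} (hz : ‖z‖ < 1 / 3) :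
    Summable fun q : ℕ × ℕ => poch a q.1 * poch e q.1 / (q.1.factorial * poch c q.1) *
      (-z) ^ q.1 * (poch (a + q.1) q.2 / q.2.factorial * z ^ q.2) := by
  set A : ℕ → ℂ := fun n => poch a n * poch e n / (n.factorial * poch c n) with hA
  have hpos : 0 < 1 - ‖z‖ := by linarith
  have hnorm (n : ℕ) : HasSum (fun k => ‖A n‖ * ‖z‖ ^ n *
      (‖poch ((‖a‖ + n : ℝ) : ℂ) k‖ / k.factorial * ‖z‖ ^ k))
      (‖A n‖ * ‖z‖ ^ n * (1 - ‖z‖) ^ (-(‖a‖ + n))) :=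
    (hasSum_norm_poch_mul_pow (by positivity) (norm_nonneg z) (by linarith)).mul_left _
  refine Summable.of_norm_bounded (g := fun q : ℕ × ℕ => ‖A q.1‖ * ‖z‖ ^ q.1 *
    (‖poch ((‖a‖ + q.1 : ℝ) : ℂ) q.2‖ / q.2.factorial * ‖z‖ ^ q.2)) ?_ ?_
  · refine (summable_prod_of_nonneg fun q => by positivity).2
      ⟨fun n => (hnorm n).summable, ?_⟩
    simp only [fun n => (hnorm n).tsum_eq]
    refine ((summable_norm_hypergeometric_term a e c (ρ := ‖z‖ / (1 - ‖z‖)) (by positivity)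
      (by rw [div_lt_one hpos]; linarith)).mul_right ((1 - ‖z‖) ^ (-‖a‖))).congr fun n => ?_
    rw [neg_add, Real.rpow_add hpos, Real.rpow_neg hpos.le (n : ℝ), Real.rpow_natCast, div_pow]
    ring
  · rintro ⟨n, k⟩
    rw [norm_mul, norm_mul, norm_mul, norm_div (poch (a + n) k), norm_pow, norm_pow, norm_neg,
      Complex.norm_natCast]
    gcongr
    exact norm_poch_add_natCast_le a n k

theorem pfaff_coefficient (a e : ℂ) {c : ℂ} (hc : 0 < c.re) (z : ℂ) (N : ℕ) :
    ∑ q ∈ Finset.HasAntidiagonal.antidiagonal N,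
      poch a q.1 * poch e q.1 / (q.1.factorial * poch c q.1) *
        (-z) ^ q.1 * (poch (a + q.1) q.2 / q.2.factorial * z ^ q.2) =
      poch a N * poch (c - e) N / (N.factorial * poch c N) * z ^ N := by
  rw [← sum_antidiagonal_poch c e N, Finset.mul_sum, Finset.sum_div, Finset.sum_mul]
  refine Finset.sum_congr rfl fun q hq => ?_
  rw [Finset.HasAntidiagonal.mem_antidiagonal] at hq
  obtain ⟨n, k⟩ := q
  simp only at hq
  subst hq
  simp only
  rw [Nat.cast_add_choose, poch_add a, poch_add c, neg_pow, pow_add]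
  have := poch_ne_zero hc n
  have : poch (c + n) k ≠ 0 :=
    poch_ne_zero (by simp only [Complex.add_re, Complex.natCast_re]; positivity) k
  have : (n.factorial : ℂ) ≠ 0 := by exact_mod_cast n.factorial_ne_zero
  have : (k.factorial : ℂ) ≠ 0 := by exact_mod_cast k.factorial_ne_zero
  have : ((n + k).factorial : ℂ) ≠ 0 := by exact_mod_cast (n + k).factorial_ne_zero
  field_simp

/-- One double series summed in two ways: rows give Pfaff's side, and antidiagonals give the Gauss
series by Chu–Vandermonde with e = c-b. -/
theorem pfaff2F1_eq_ordinaryHypergeometric (a b : ℂ) {c z : ℂ} (hc : 0 < c.re)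
    (hz : ‖z‖ < 1 / 3) : pfaff2F1 a b c z = ordinaryHypergeometric a b c z := by
  have hre : z.re < 1 / 2 := by linarith [Complex.re_le_norm z]
  have h1z : 1 - z ≠ 0 := fun h => by
    have := congrArg Complex.re h
    simp at this; linarith
  have hrow (n : ℕ) := (hasSum_one_sub_cpow_neg (a + n) (z := z) (by linarith)).mul_left
    (poch a n * poch (c - b) n / (n.factorial * poch c n) * (-z) ^ n)
  have hfsum := summable_pfaff a (c - b) c hz
  have hleft : HasSum (fun n : ℕ => poch a n * poch (c - b) n / (n.factorial * poch c n) *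
      (-z) ^ n * (1 - z) ^ (-(a + n))) (pfaff2F1 a b c z) := by
    have h := (hasSum_ordinaryHypergeometric a (c - b) c (norm_div_sub_one_lt_one hre)).mul_left
      ((1 - z) ^ (-a))
    refine h.congr_fun fun n => ?_
    rw [neg_add, Complex.cpow_add _ _ h1z, Complex.cpow_neg _ (n : ℂ), Complex.cpow_natCast,
      show z / (z - 1) = -z / (1 - z) by rw [← neg_sub, div_neg, neg_div], div_pow]
    ring
  have h1 := hfsum.hasSum
  rw [(hfsum.hasSum.prod_fiberwise hrow).unique hleft] at h1
  have h2 := (Finset.HasAntidiagonal.sigmaAntidiagonalEquivProd (A := ℕ)).hasSum_iff.2 h1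
  have h3 := h2.sigma fun N => (hasSum_fintype _)
  refine h3.unique ((hasSum_ordinaryHypergeometric a b c (by linarith)).congr_fun fun N => ?_)
  have h4 := pfaff_coefficient a (c - b) hc z N
  rw [sub_sub_cancel] at h4
  rw [← h4]
  exact Finset.sum_coe_sort (Finset.HasAntidiagonal.antidiagonal N) fun q : ℕ × ℕ =>
    poch a q.1 * poch (c - b) q.1 / (q.1.factorial * poch c q.1) *
      (-z) ^ q.1 * (poch (a + q.1) q.2 / q.2.factorial * z ^ q.2)

/-- This existence is what makes the choice in `gauss2F1` a genuine continuation. -/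
theorem isGaussContinuation_pfaff2F1 (a b : ℂ) {c : ℂ} (hc : 0 < c.re) :
    IsGaussContinuation a b c (pfaff2F1 a b c) := by
  refine ⟨differentiableOn_pfaff2F1 a b c, ?_⟩
  filter_upwards [Metric.ball_mem_nhds (0 : ℂ) (show (0 : ℝ) < 1 / 3 by norm_num)] with z hz
  exact pfaff2F1_eq_ordinaryHypergeometric a b hc (by simpa using hz)

theorem isOpen_re_lt (t : ℝ) : IsOpen {z : ℂ | z.re < t} :=
  isOpen_lt Complex.continuous_re continuous_const

theorem IsGaussContinuation.eqOn {a b c : ℂ} {F G : ℂ → ℂ} (hF : IsGaussContinuation a b c F)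
    (hG : IsGaussContinuation a b c G) : EqOn F G {z : ℂ | z.re < 1 / 2} := by
  refine (hF.1.analyticOnNhd (isOpen_re_lt _)).eqOn_of_preconnected_of_eventuallyEq
    (hG.1.analyticOnNhd (isOpen_re_lt _)) (convex_halfSpace_re_lt _).isPreconnected (z₀ := 0)
    (by simp) (hF.2.trans hG.2.symm)

theorem gauss2F1_spec (a b : ℂ) {c : ℂ} (hc : 0 < c.re) :
    IsGaussContinuation a b c (gauss2F1 a b c) :=
  Classical.epsilon_spec ⟨_, isGaussContinuation_pfaff2F1 a b hc⟩

theorem gauss2F1_comm (a b c : ℂ) : gauss2F1 a b c = gauss2F1 b a c := by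
  unfold gauss2F1 IsGaussContinuation ordinaryHypergeometric
  rw [ordinaryHypergeometricSeries_symm]

theorem gauss2F1_eq_pfaff2F1 (a b : ℂ) {c z : ℂ} (hc : 0 < c.re) (hz : z.re < 1 / 2) :
    gauss2F1 a b c z = pfaff2F1 a b c z :=
  (gauss2F1_spec a b hc).eqOn (isGaussContinuation_pfaff2F1 a b hc) hz

/-! ### The one-variable integral without a power of x/(1+x). -/

theorem integrable_tsum_of_summable_integral_norm {α ι E : Type*} [Countable ι]
    [MeasurableSpace α] {ν : Measure α} [NormedAddCommGroup E] {F : ι → α → E} {f : α → E}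
    (hf : AEStronglyMeasurable f ν) (hfF : ∀ᵐ x ∂ν, f x = ∑' i, F i x)
    (hF : ∀ i, Integrable (F i) ν) (hsum : Summable fun i => ∫ x, ‖F i x‖ ∂ν) :
    Integrable f ν := by
  refine ⟨hf, ?_⟩
  calc ∫⁻ x, ‖f x‖ₑ ∂ν ≤ ∫⁻ x, ∑' i, ‖F i x‖ₑ ∂ν := by
        refine lintegral_mono_ae ?_
        filter_upwards [hfF] with x hx
        rw [hx]
        exact enorm_tsum_le_tsum_enorm
    _ = ∑' i, ∫⁻ x, ‖F i x‖ₑ ∂ν := lintegral_tsum fun i => (hF i).1.enorm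
    _ = ∑' i, ENNReal.ofReal (∫ x, ‖F i x‖ ∂ν) := by
        simp only [ofReal_integral_norm_eq_lintegral_enorm (hF _)]
    _ < ⊤ := hsum.tsum_ofReal_lt_top

theorem pfaff2F1_neg_ofReal (a b c : ℂ) {x : ℝ} (hx : 0 ≤ x) :
    HasSum (fun n : ℕ => poch a n * poch (c - b) n / (n.factorial * poch c n) *
      ((x : ℂ) ^ n * (1 + x : ℂ) ^ (-(a + n)))) (pfaff2F1 a b c (-x)) := by
  have h1x : (1 + x : ℂ) ≠ 0 := by
    have : (0 : ℝ) < 1 + x := by linarith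
    exact_mod_cast this.ne'
  have h := (hasSum_ordinaryHypergeometric a (c - b) c (norm_div_sub_one_lt_one
    (z := -(x : ℂ)) (by simp; linarith))).mul_left ((1 - -(x : ℂ)) ^ (-a))
  refine h.congr_fun fun n => ?_
  rw [sub_neg_eq_add, neg_add, Complex.cpow_add _ _ h1x, Complex.cpow_neg _ (n : ℂ),
    Complex.cpow_natCast, show -(x : ℂ) / (-x - 1) = x / (1 + x) by
      rw [← neg_add', neg_div_neg_eq, add_comm], div_pow]
  ring

theorem continuousOn_gauss2F1_neg (a b : ℂ) {c : ℂ} (hc : 0 < c.re) :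
    ContinuousOn (fun x : ℝ => gauss2F1 a b c (-x)) (Ioi 0) := by
  refine (gauss2F1_spec a b hc).1.continuousOn.comp (by fun_prop) fun x hx => ?_
  simp only [mem_ofPred_eq, Complex.neg_re, Complex.ofReal_re]
  linarith [mem_Ioi.1 hx]

theorem continuousOn_one_add_cpow (w : ℂ) :
    ContinuousOn (fun x : ℝ => (1 + x : ℂ) ^ w) (Ioi 0) := by
  refine ContinuousOn.cpow (by fun_prop) (by fun_prop) fun x hx => Or.inl ?_
  simp
  linarith [mem_Ioi.1 hx]

theorem natCast_factorial_add (d n : ℕ) :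
    ((d + n).factorial : ℂ) = d.factorial * poch (d + 1) n := by
  rw [← Complex.Gamma_nat_eq_factorial, ← Complex.Gamma_nat_eq_factorial, ← Gamma_add_natCast]
  · congr 1; push_cast; ring
  · simp only [Complex.add_re, Complex.natCast_re, Complex.one_re]; positivity

/-- Since (d+1) - b = a, Pfaff's series has coefficients (a)_n²/(n! (d+1)_n). The beta integral of
the n-th term contributes (d+n)!, which cancels (d+1)_n and leaves ₂F₁(a, a; β+a; 1), convergent
because Re a < β. -/
theorem integral_gauss2F1_of_re_pos (d : ℕ) {a b : ℂ} {β : ℝ} (hab : a + b = d + 1)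
    (ha0 : 0 < a.re) (ha : a.re < β) (hb : b.re < β) :
    IntegrableOn (fun x : ℝ => (x : ℂ) ^ d * (1 + x : ℂ) ^ (-β : ℂ) *
      gauss2F1 a b (d + 1) (-x)) (Ioi 0) ∧
    ∫ x in Ioi (0 : ℝ), (x : ℂ) ^ d * (1 + x : ℂ) ^ (-β : ℂ) * gauss2F1 a b (d + 1) (-x) =
      d.factorial * (Complex.Gamma (β - a) * Complex.Gamma (β - b)) / Complex.Gamma β ^ 2 := by
  have hc : 0 < ((d : ℂ) + 1).re := by
    simp only [Complex.add_re, Complex.natCast_re, Complex.one_re]; positivity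
  have habre : a.re + b.re = d + 1 := by simpa using congrArg Complex.re hab
  have hβa : 0 < ((β : ℂ) + a).re := by simp; linarith
  set A : ℕ → ℂ := fun n => poch a n * poch a n / (n.factorial * poch (d + 1) n) with hA
  set F : ℕ → ℝ → ℂ := fun n x =>
    A n * ((x : ℂ) ^ (d + n) * (1 + x : ℂ) ^ (-(β + a + n) : ℂ)) with hF
  have hw (n : ℕ) : ((d + n : ℕ) : ℝ) + 1 < ((β : ℂ) + a + n).re := by
    simp; linarith
  have hfF (x : ℝ) (hx : x ∈ Ioi 0) : (x : ℂ) ^ d * (1 + x : ℂ) ^ (-β : ℂ) *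
      gauss2F1 a b (d + 1) (-x) = ∑' n, F n x := by
    have hx0 : (0 : ℝ) < x := hx
    have h1x : (1 + x : ℂ) ≠ 0 := by
      have : (0 : ℝ) < 1 + x := by linarith
      exact_mod_cast this.ne'
    rw [gauss2F1_eq_pfaff2F1 a b hc (by simp; linarith)]
    have h := (pfaff2F1_neg_ofReal a b (d + 1) hx0.le).mul_left
      ((x : ℂ) ^ d * (1 + x : ℂ) ^ (-β : ℂ))
    rw [← h.tsum_eq]
    refine tsum_congr fun n => ?_
    simp only [hF, hA]
    rw [← hab, add_sub_cancel_right, pow_add,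
      show -((β : ℂ) + a + n) = -β + -(a + n) by ring, Complex.cpow_add _ _ h1x]
    ring
  have hFint (n : ℕ) : IntegrableOn (F n) (Ioi 0) :=
    (integral_pow_mul_one_add_cpow (d + n) _ (hw n)).1.const_mul _
  have hFval (n : ℕ) : ∫ x in Ioi (0 : ℝ), F n x =
      d.factorial * Complex.Gamma (β - b) / Complex.Gamma (β + a) *
        (poch a n * poch a n / (n.factorial * poch (β + a) n)) := by
    rw [hF, integral_const_mul, (integral_pow_mul_one_add_cpow (d + n) _ (hw n)).2,
      natCast_factorial_add, Gamma_add_natCast hβa,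
      show (β : ℂ) + a + n - ((d + n : ℕ) : ℂ) - 1 = β - b by
        push_cast; linear_combination hab]
    simp only [hA]
    have := Complex.Gamma_ne_zero_of_re_pos hβa
    have := poch_ne_zero hβa n
    have := poch_ne_zero hc n
    have : (n.factorial : ℂ) ≠ 0 := by exact_mod_cast n.factorial_ne_zero
    field_simp
  have hsum : Summable fun n => ∫ x in Ioi (0 : ℝ), ‖F n x‖ := by
    have hβa' : 0 < (((β + a.re : ℝ) : ℂ)).re := by simp; linarith
    have h := (summable_poch_mul_poch_div (a := a) (b := a) (c := ((β + a.re : ℝ) : ℂ))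
      ha0 ha0 (by simpa using ha)).mul_left
      ‖d.factorial * Complex.Gamma ((β - b.re : ℝ) : ℂ) / Complex.Gamma ((β + a.re : ℝ) : ℂ)‖
    refine h.congr fun n => ?_
    simp only [hF, norm_mul (A n)]
    rw [integral_const_mul, integral_norm_pow_mul_one_add_cpow _ _ (hw n), ← norm_mul, ← norm_mul,
      natCast_factorial_add,
      show (((β : ℂ) + a + n).re : ℂ) - ((d + n : ℕ) : ℂ) - 1 = ((β - b.re : ℝ) : ℂ) by
        have : (a.re : ℂ) + b.re = d + 1 := by exact_mod_cast habre
        simp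
        linear_combination this,
      show (((β : ℂ) + a + n).re : ℂ) = ((β + a.re : ℝ) : ℂ) + n by simp,
      Gamma_add_natCast hβa']
    congr 1
    simp only [hA]
    have := Complex.Gamma_ne_zero_of_re_pos hβa'
    have := poch_ne_zero hβa' n
    have := poch_ne_zero hc n
    have : (n.factorial : ℂ) ≠ 0 := by exact_mod_cast n.factorial_ne_zero
    field_simp
  constructor
  · refine integrable_tsum_of_summable_integral_norm ?_ ?_ hFint hsum
    · refine ContinuousOn.aestronglyMeasurable ?_ measurableSet_Ioi
      exact (ContinuousOn.mul (by fun_prop) (continuousOn_one_add_cpow _)).mul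
        (continuousOn_gauss2F1_neg a b hc)
    · exact (ae_restrict_iff' measurableSet_Ioi).2 (Eventually.of_forall hfF)
  · rw [setIntegral_congr_fun measurableSet_Ioi hfF]
    have key := hasSum_integral_of_summable_integral_norm hFint hsum
    simp only [hFval] at key
    have hg := (hasSum_gauss (c := β + a) ha0 ha0 (by simpa using ha)).mul_left
      (d.factorial * Complex.Gamma (β - b) / Complex.Gamma (β + a))
    rw [key.unique hg, add_sub_cancel_right]
    have := Complex.Gamma_ne_zero_of_re_pos hβa
    field_simp

/-- As Re a + Re b = d+1 > 0, one of a, b has positive real part, and the claim is symmetric in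
them. -/
theorem integral_gauss2F1 (d : ℕ) {a b : ℂ} {β : ℝ} (hab : a + b = d + 1)
    (ha : a.re < β) (hb : b.re < β) :
    IntegrableOn (fun x : ℝ => (x : ℂ) ^ d * (1 + x : ℂ) ^ (-β : ℂ) *
      gauss2F1 a b (d + 1) (-x)) (Ioi 0) ∧
    ∫ x in Ioi (0 : ℝ), (x : ℂ) ^ d * (1 + x : ℂ) ^ (-β : ℂ) * gauss2F1 a b (d + 1) (-x) =
      d.factorial * (Complex.Gamma (β - a) * Complex.Gamma (β - b)) / Complex.Gamma β ^ 2 := by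
  rcases lt_or_ge 0 a.re with h | h
  · exact integral_gauss2F1_of_re_pos d hab h ha hb
  · have habre : a.re + b.re = d + 1 := by simpa using congrArg Complex.re hab
    rw [gauss2F1_comm, mul_comm (Complex.Gamma _)]
    exact integral_gauss2F1_of_re_pos d (by rw [add_comm, hab]) (by
      have : (0 : ℝ) ≤ d := d.cast_nonneg
      linarith) hb ha

/-! ### Continuous dual Hahn polynomials from the one-variable integral. -/

theorem poch_neg_natCast (m k : ℕ) :
    poch (-m) k = (-1) ^ k * (m.choose k * k.factorial) := by
  have h := ascPochhammer_eval_neg_eq_descPochhammer ℂ (m : ℂ) k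
  rw [poch, h, descPochhammer_eval_eq_descFactorial, Nat.descFactorial_eq_factorial_mul_choose]
  push_cast
  ring

/-- The continuous dual Hahn polynomial as a finite sum. -/
theorem dualHahn_eq_sum (m : ℕ) (s a b c : ℂ) :
    dualHahn m s a b c = poch (a + b) m * poch (a + c) m *
      ∑ k ∈ Finset.range (m + 1), (-1) ^ k * m.choose k *
        (poch (a + Complex.I * s) k * poch (a - Complex.I * s) k /
          (poch (a + b) k * poch (a + c) k)) := by
  rw [dualHahn, hyper3F2, tsum_eq_sum (s := Finset.range (m + 1))]
  · congr 1
    refine Finset.sum_congr rfl fun k _ => ?_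
    have : (k.factorial : ℂ) ≠ 0 := by exact_mod_cast k.factorial_ne_zero
    rw [poch_neg_natCast, one_pow, mul_one, mul_assoc (k.factorial : ℂ)]
    rw [show (-1 : ℂ) ^ k * (m.choose k * k.factorial) * poch (a + Complex.I * s) k *
      poch (a - Complex.I * s) k = k.factorial * ((-1 : ℂ) ^ k * m.choose k *
      (poch (a + Complex.I * s) k * poch (a - Complex.I * s) k)) by ring,
      mul_div_mul_left _ _ this, mul_div_assoc]
  · intro k hk
    rw [poch_neg_natCast, Nat.choose_eq_zero_of_lt (by simpa [Nat.lt_succ_iff] using hk)]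
    simp

theorem integral_gauss2F1_mul_pow (d m : ℕ) {a b : ℂ} {β : ℝ} (hab : a + b = d + 1)
    (ha : a.re < β) (hb : b.re < β) :
    IntegrableOn (fun x : ℝ => (x / (1 + x) : ℂ) ^ m * ((x : ℂ) ^ d * (1 + x : ℂ) ^ (-β : ℂ)) *
      gauss2F1 a b (d + 1) (-x)) (Ioi 0) ∧
    ∫ x in Ioi (0 : ℝ), (x / (1 + x) : ℂ) ^ m * ((x : ℂ) ^ d * (1 + x : ℂ) ^ (-β : ℂ)) *
      gauss2F1 a b (d + 1) (-x) =
      d.factorial * (Complex.Gamma (β - a) * Complex.Gamma (β - b)) / Complex.Gamma β ^ 2 *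
        ∑ k ∈ Finset.range (m + 1), (-1) ^ k * m.choose k *
          (poch (β - a) k * poch (β - b) k / (poch β k * poch β k)) := by
  have habre : a.re + b.re = d + 1 := by simpa using congrArg Complex.re hab
  have hβ : 0 < β := by
    have : (0 : ℝ) ≤ d := d.cast_nonneg
    linarith
  have hk (k : ℕ) := integral_gauss2F1 d (β := β + k) hab
    (by have : (0 : ℝ) ≤ k := k.cast_nonneg
        linarith) (by have : (0 : ℝ) ≤ k := k.cast_nonneg
                      linarith)
  have hfun : EqOn (fun x : ℝ => (x / (1 + x) : ℂ) ^ m *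
      ((x : ℂ) ^ d * (1 + x : ℂ) ^ (-β : ℂ)) * gauss2F1 a b (d + 1) (-x))
      (fun x : ℝ => ∑ k ∈ Finset.range (m + 1), ((-1) ^ k * m.choose k : ℂ) *
        ((x : ℂ) ^ d * (1 + x : ℂ) ^ (-((β + k : ℝ) : ℂ)) * gauss2F1 a b (d + 1) (-x)))
      (Ioi 0) := by
    intro x hx
    have h1x : (1 + x : ℂ) ≠ 0 := by
      have : (0 : ℝ) < 1 + x := by linarith [mem_Ioi.1 hx]
      exact_mod_cast this.ne'
    -- Binomial expansion of (1 - 1/(1+x))^m; the k-th term only shifts β to β+k.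
    have hp : (x / (1 + x) : ℂ) ^ m =
        ∑ k ∈ Finset.range (m + 1), ((-1) ^ k * m.choose k : ℂ) * ((1 + x : ℂ) ^ k)⁻¹ := by
      rw [show (x / (1 + x) : ℂ) = -(1 + x : ℂ)⁻¹ + 1 by field_simp; ring, add_pow]
      refine Finset.sum_congr rfl fun k _ => ?_
      rw [neg_pow, inv_pow]
      ring
    simp only
    rw [hp, Finset.sum_mul, Finset.sum_mul]
    refine Finset.sum_congr rfl fun k _ => ?_
    push_cast
    rw [neg_add, Complex.cpow_add _ _ h1x, Complex.cpow_neg _ (k : ℂ), Complex.cpow_natCast]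
    ring
  refine ⟨Integrable.congr
    (integrable_finsetSum (Finset.range (m + 1)) fun k _ =>
      (hk k).1.const_mul ((-1) ^ k * m.choose k : ℂ)) ?_, ?_⟩
  · exact (ae_restrict_iff' measurableSet_Ioi).2
      (Eventually.of_forall fun x hx => (hfun hx).symm)
  · rw [setIntegral_congr_fun measurableSet_Ioi hfun,
      integral_finsetSum _ fun k _ => (hk k).1.const_mul _, Finset.mul_sum]
    refine Finset.sum_congr rfl fun k _ => ?_
    rw [integral_const_mul, (hk k).2]
    push_cast
    rw [show (β : ℂ) + k - a = (β - a) + k by ring, show (β : ℂ) + k - b = (β - b) + k by ring,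
      Gamma_add_natCast (by simpa), Gamma_add_natCast (by simpa), Gamma_add_natCast (by simpa)]
    have : Complex.Gamma β ≠ 0 := Complex.Gamma_ne_zero_of_re_pos (by simpa)
    have : poch β k ≠ 0 := poch_ne_zero (by simpa) k
    field_simp

/-! ### Integrals of products of determinants. -/

/-- **Andréief's identity**, with the integrability of the product of determinants. -/
theorem integral_det_mul_det {ι α : Type*} [Fintype ι] [DecidableEq ι] [MeasurableSpace α]
    (ν : Measure α) [SigmaFinite ν] (f g : ι → α → ℂ)
    (hfg : ∀ i j, Integrable (fun x => f i x * g j x) ν) :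
    Integrable (fun x : ι → α => (Matrix.of fun k l => f l (x k)).det *
      (Matrix.of fun k j => g j (x k)).det) (Measure.pi fun _ => ν) ∧
    ∫ x : ι → α, (Matrix.of fun k l => f l (x k)).det * (Matrix.of fun k j => g j (x k)).det
      ∂(Measure.pi fun _ => ν) =
      (Fintype.card ι).factorial * (Matrix.of fun i j => ∫ x, f i x * g j x ∂ν).det := by
  have hexp (x : ι → α) : (Matrix.of fun k l => f l (x k)).det *
      (Matrix.of fun k j => g j (x k)).det =
      ∑ σ : Equiv.Perm ι, ∑ τ : Equiv.Perm ι,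
        ((Equiv.Perm.sign σ : ℤ) * (Equiv.Perm.sign τ : ℤ) : ℂ) *
          ∏ k, (f (σ k) (x k) * g (τ k) (x k)) := by
    rw [← Matrix.det_transpose, ← Matrix.det_transpose (Matrix.of fun k j => g j (x k)),
      Matrix.det_apply', Matrix.det_apply', Finset.sum_mul_sum]
    refine Finset.sum_congr rfl fun σ _ => Finset.sum_congr rfl fun τ _ => ?_
    simp only [Matrix.transpose_apply, Matrix.of_apply, Finset.prod_mul_distrib]
    ring
  have hint (σ τ : Equiv.Perm ι) : Integrable (fun x : ι → α =>
      ((Equiv.Perm.sign σ : ℤ) * (Equiv.Perm.sign τ : ℤ) : ℂ) *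
        ∏ k, (f (σ k) (x k) * g (τ k) (x k))) (Measure.pi fun _ => ν) :=
    (Integrable.fintype_prod fun k => hfg (σ k) (τ k)).const_mul _
  simp only [hexp]
  refine ⟨integrable_finsetSum _ fun σ _ => integrable_finsetSum _ fun τ _ => hint σ τ, ?_⟩
  rw [integral_finsetSum _ fun σ _ => integrable_finsetSum _ fun τ _ => hint σ τ]
  set M : Matrix ι ι ℂ := Matrix.of fun i j => ∫ x, f i x * g j x ∂ν with hM
  -- For fixed σ, the sum over τ is a determinant with rows permuted by σ; its sign cancels sign σ,
  -- so all σ contribute equally.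
  have hterm (σ : Equiv.Perm ι) : ∫ x : ι → α, ∑ τ : Equiv.Perm ι,
      ((Equiv.Perm.sign σ : ℤ) * (Equiv.Perm.sign τ : ℤ) : ℂ) *
        ∏ k, (f (σ k) (x k) * g (τ k) (x k)) ∂(Measure.pi fun _ => ν) = M.det := by
    rw [integral_finsetSum _ fun τ _ => hint σ τ]
    have hτ (τ : Equiv.Perm ι) : ∫ x : ι → α,
        ((Equiv.Perm.sign σ : ℤ) * (Equiv.Perm.sign τ : ℤ) : ℂ) *
          ∏ k, (f (σ k) (x k) * g (τ k) (x k)) ∂(Measure.pi fun _ => ν) =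
        (Equiv.Perm.sign σ : ℤ) * ((Equiv.Perm.sign τ : ℤ) * ∏ k, M (σ k) (τ k)) := by
      rw [integral_const_mul, integral_fintype_prod_eq_prod
        (fun k x => f (σ k) x * g (τ k) x), mul_assoc]
      rfl
    have hdet := Matrix.det_permute σ M
    rw [← Matrix.det_transpose, Matrix.det_apply'] at hdet
    simp only [Matrix.transpose_apply, Matrix.submatrix_apply, id] at hdet
    simp only [hτ, ← Finset.mul_sum, hdet]
    rw [← mul_assoc, ← Int.cast_mul, Int.units_coe_mul_self]
    simp
  simp only [hterm]
  simp [Fintype.card_perm]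

/-! ### Schur functions and Δ_μ in radial coordinates. -/

theorem diffProd_eq_det_vandermonde {R : Type*} [CommRing R] {p : ℕ} (y : Fin p → R) :
    diffProd y = (Matrix.vandermonde fun k => -y k).det := by
  rw [Matrix.det_vandermonde, diffProd]
  exact Finset.prod_congr rfl fun k _ => Finset.prod_congr rfl fun l _ => by ring

theorem diffProd_comp_perm {R : Type*} [CommRing R] {p : ℕ} (y : Fin p → R)
    (σ : Equiv.Perm (Fin p)) : diffProd (y ∘ σ) = (Equiv.Perm.sign σ : ℤ) * diffProd y := by
  rw [diffProd_eq_det_vandermonde, diffProd_eq_det_vandermonde, ← Matrix.det_permute]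
  rfl

theorem diffProd_ne_zero {R : Type*} [CommRing R] [IsDomain R] {p : ℕ} {y : Fin p → R}
    (hy : Function.Injective y) : diffProd y ≠ 0 :=
  Finset.prod_ne_zero_iff.2 fun _ _ => Finset.prod_ne_zero_iff.2 fun _ hl =>
    sub_ne_zero.2 (hy.ne (Finset.mem_Ioi.1 hl).ne)

theorem continuous_diffProd {p : ℕ} : Continuous fun y : Fin p → ℝ => diffProd y := by
  unfold diffProd
  fun_prop

theorem schurFun_of_injective {p : ℕ} (μ : Fin p → ℕ) {y : Fin p → ℝ}
    (hy : Function.Injective y) : schurFun μ y =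
      (Matrix.of fun k l : Fin p => y k ^ (μ l + (p - 1 - (l : ℕ)))).det / diffProd y := by
  refine extendFrom_extends (ContinuousOn.div ?_ continuous_diffProd.continuousOn
    fun z hz => diffProd_ne_zero hz) y hy
  refine (Continuous.matrix_det ?_).continuousOn
  refine continuous_matrix fun k l => ?_
  simp only [Matrix.of_apply]
  fun_prop

/-- Numerator and denominator are both alternating. This is needed because the order in which
`eigenvalues` lists the spectrum need not be that of the x_k. -/
theorem schurFun_comp_perm {p : ℕ} (μ : Fin p → ℕ) {y : Fin p → ℝ}
    (hy : Function.Injective y) (σ : Equiv.Perm (Fin p)) :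
    schurFun μ (y ∘ σ) = schurFun μ y := by
  rw [schurFun_of_injective μ hy, schurFun_of_injective μ (hy.comp σ.injective),
    diffProd_comp_perm]
  have h := Matrix.det_permute σ (Matrix.of fun k l : Fin p => y k ^ (μ l + (p - 1 - (l : ℕ))))
  rw [← mul_div_mul_left _ (diffProd y)
    (show (((Equiv.Perm.sign σ : ℤˣ) : ℤ) : ℝ) ≠ 0 by
      exact_mod_cast (Equiv.Perm.sign σ).ne_zero), ← h]
  rfl

theorem exists_perm_of_map_eq {ι β : Type*} [Finite ι] [Fintype ι] {u y : ι → β}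
    (hy : Function.Injective y)
    (h : Finset.univ.val.map u = Finset.univ.val.map y) :
    ∃ σ : Equiv.Perm ι, u = y ∘ σ := by
  have hu : Function.Injective u := by
    have hnd : (Finset.univ.val.map u).Nodup := h ▸ Finset.univ.nodup.map hy
    exact fun i j hij => Multiset.inj_on_of_nodup_map hnd i (Finset.mem_univ i) j
      (Finset.mem_univ j) hij
  have hex (i : ι) : ∃ j, y j = u i := by
    have : u i ∈ Finset.univ.val.map y := h ▸ Multiset.mem_map_of_mem u (Finset.mem_univ i)
    simpa using this
  choose σ hσ using hex
  have hσi : Function.Injective σ := fun i j hij => hu (by rw [← hσ, ← hσ, hij])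
  exact ⟨Equiv.ofBijective σ (Finite.injective_iff_bijective.1 hσi), funext fun i => (hσ i).symm⟩

theorem radialPoint_mul_conjTranspose {p q : ℕ} (hpq : p ≤ q) {x : Fin p → ℝ}
    (hx : ∀ k, 0 ≤ x k) : radialPoint q x * (radialPoint q x).conjTranspose =
      Matrix.diagonal fun k => ((x k / (1 + x k) : ℝ) : ℂ) := by
  ext i j
  rw [Matrix.mul_apply, Finset.sum_eq_single (Fin.castLE hpq i)]
  · by_cases hij : i = j
    · subst hij
      have : 0 ≤ x i / (1 + x i) := div_nonneg (hx i) (by linarith [hx i])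
      simp only [radialPoint, Matrix.of_apply, Matrix.conjTranspose_apply, Fin.val_castLE,
        if_true, Matrix.diagonal_apply_eq, RCLike.star_def, Complex.conj_ofReal]
      rw [← Complex.ofReal_mul, Real.mul_self_sqrt this]
    · have : (i : ℕ) ≠ j := fun h => hij (Fin.ext h)
      simp [radialPoint, Matrix.diagonal_apply_ne _ hij, this]
  · intro l _ hl
    have : (l : ℕ) ≠ i := fun h => hl (Fin.ext h)
    simp [radialPoint, this]
  · simp

/-- Both families are the roots of the characteristic polynomial, hence equal as multisets. -/
theorem eigenvalues_of_eq_diagonal {p : ℕ} {A : Matrix (Fin p) (Fin p) ℂ} (hA : A.IsHermitian)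
    {y : Fin p → ℝ} (hy : Function.Injective y)
    (hAy : A = Matrix.diagonal fun k => (y k : ℂ)) :
    ∃ σ : Equiv.Perm (Fin p), hA.eigenvalues = y ∘ σ := by
  refine exists_perm_of_map_eq hy ?_
  have h := hA.roots_charpoly_eq_eigenvalues
  have h2 : A.charpoly.roots = Finset.univ.val.map fun k => (y k : ℂ) := by
    rw [hAy, Matrix.charpoly_diagonal]
    have := Polynomial.roots_multiset_prod_X_sub_C (Finset.univ.val.map fun k => (y k : ℂ))
    rwa [Multiset.map_map] at this
  rw [h2] at h
  have h3 := congrArg (Multiset.map Complex.re) h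
  rw [Multiset.map_map, Multiset.map_map] at h3
  exact h3.symm

theorem diffProd_div_one_add {p : ℕ} {x : Fin p → ℝ} (hx : ∀ k, 0 ≤ x k) :
    diffProd (fun k => x k / (1 + x k)) = diffProd x * ∏ k, ((1 + x k) ^ (p - 1))⁻¹ := by
  have h := Finset.prod_prod_Ioi_mul_eq_prod_prod_off_diag fun (_ : Fin p) k => (1 + x k)⁻¹
  -- Each index occurs in p-1 of the pairs.
  have h2 : ∏ k, ((1 + x k) ^ (p - 1))⁻¹ =
      ∏ k, ∏ l ∈ Finset.Ioi k, ((1 + x k)⁻¹ * (1 + x l)⁻¹) := by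
    rw [h]
    refine Finset.prod_congr rfl fun k _ => ?_
    rw [Finset.prod_const, Finset.card_compl, Finset.card_singleton, Fintype.card_fin, inv_pow]
  rw [h2, diffProd, diffProd, ← Finset.prod_mul_distrib]
  refine Finset.prod_congr rfl fun k _ => ?_
  rw [← Finset.prod_mul_distrib]
  refine Finset.prod_congr rfl fun l _ => ?_
  have hk : 1 + x k ≠ 0 := by linarith [hx k]
  have hl : 1 + x l ≠ 0 := by linarith [hx l]
  field_simp
  ring

/-- In the exponent p-1-α, the part -α comes from det(1 - zz*) = ∏ (1+x_k)⁻¹ and p-1 from the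
Vandermonde of the eigenvalues. -/
theorem canonicalBasis_radialPoint {p q : ℕ} (hpq : p ≤ q) (α : ℝ) (μ : Fin p → ℕ)
    {x : Fin p → ℝ} (hx : ∀ k, 0 ≤ x k) (hinj : Function.Injective x) :
    canonicalBasis α μ (radialPoint q x) =
      (((Matrix.of fun k l : Fin p => (x k / (1 + x k)) ^ (μ l + (p - 1 - (l : ℕ)))).det *
        (∏ k, (1 + x k) ^ ((p : ℝ) - 1 - α)) / diffProd x : ℝ) : ℂ) := by
  have hpos (k : Fin p) : 0 < 1 + x k := by linarith [hx k]
  set y : Fin p → ℝ := fun k => x k / (1 + x k) with hy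
  have hyinj : Function.Injective y := fun k l hkl => hinj (by
    simp only [hy] at hkl
    have := hpos k; have := hpos l
    field_simp at hkl
    linarith)
  have hdiag := radialPoint_mul_conjTranspose hpq hx
  obtain ⟨σ, hσ⟩ := eigenvalues_of_eq_diagonal
    (Matrix.isHermitian_mul_conjTranspose_self (radialPoint q x)) hyinj hdiag
  have hdet : (1 - radialPoint q x * (radialPoint q x).conjTranspose).det.re =
      ∏ k, (1 + x k)⁻¹ := by
    rw [hdiag, ← Matrix.diagonal_one, Matrix.diagonal_sub, Matrix.det_diagonal]
    have : ∏ k, ((1 : ℂ) - ((x k / (1 + x k) : ℝ) : ℂ)) = ((∏ k, (1 + x k)⁻¹ : ℝ) : ℂ) := by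
      rw [Complex.ofReal_prod]
      refine Finset.prod_congr rfl fun k _ => ?_
      rw [← Complex.ofReal_one, ← Complex.ofReal_sub]
      congr 1
      have := hpos k
      field_simp
      ring
    rw [this, Complex.ofReal_re]
  rw [canonicalBasis, hσ, schurFun_comp_perm μ hyinj, schurFun_of_injective μ hyinj, hdet,
    diffProd_div_one_add hx]
  congr 1
  have hpow : (∏ k, (1 + x k)⁻¹) ^ α = ∏ k, (1 + x k) ^ (-α) := by
    rw [← Real.finsetProd_rpow _ _ fun k _ => (inv_pos.2 (hpos k)).le]
    refine Finset.prod_congr rfl fun k _ => ?_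
    rw [Real.inv_rpow (hpos k).le, Real.rpow_neg (hpos k).le]
  have hsplit : ∏ k, (1 + x k) ^ ((p : ℝ) - 1 - α) =
      (∏ k, ((1 + x k) ^ (p - 1))⁻¹)⁻¹ * ∏ k, (1 + x k) ^ (-α) := by
    rw [← Finset.prod_inv_distrib, ← Finset.prod_mul_distrib]
    refine Finset.prod_congr rfl fun k _ => ?_
    rw [inv_inv, sub_eq_add_neg, Real.rpow_add (hpos k), ← Real.rpow_natCast,
      Nat.cast_sub (by have := k.2; omega)]
    simp
  have hne : ∏ k, ((1 + x k) ^ (p - 1))⁻¹ ≠ 0 :=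
    Finset.prod_ne_zero_iff.2 fun k _ => by have := hpos k; positivity
  have := diffProd_ne_zero hinj
  rw [hpow, hsplit]
  generalize ∏ k, ((1 + x k) ^ (p - 1))⁻¹ = P at hne
  field_simp
  simp only [hy]
  ring

/-! ### Reduction to one-variable integrals and conclusion. -/

/-- Each hyperplane x_k = x_l is a proper subspace, hence null, so coinciding coordinates do not
affect the integral. -/
theorem ae_injective_pi (p : ℕ) :
    ∀ᵐ x : Fin p → ℝ, Function.Injective x := by
  have h (k l : Fin p) : ∀ᵐ x : Fin p → ℝ, k ≠ l → x k ≠ x l := by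
    by_cases hkl : k = l
    · exact Eventually.of_forall fun x h => absurd hkl h
    · let φ : (Fin p → ℝ) →ₗ[ℝ] ℝ :=
        LinearMap.proj (R := ℝ) (φ := fun _ : Fin p => ℝ) k - LinearMap.proj l
      have hne : LinearMap.ker φ ≠ ⊤ := by
        intro htop
        have hmem : Pi.single k (1 : ℝ) ∈ LinearMap.ker φ := htop ▸ Submodule.mem_top
        have : k ≠ l := hkl
        simp [φ, this.symm] at hmem
      have h0 := Measure.addHaar_submodule (volume : Measure (Fin p → ℝ)) _ hne
      have h1 : ∀ᵐ x : Fin p → ℝ, x ∉ LinearMap.ker φ := measure_eq_zero_iff_ae_notMem.1 h0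
      filter_upwards [h1] with x hx _ hx'
      exact hx (by simp [φ, hx'])
  have h2 := ae_all_iff.2 fun k => ae_all_iff.2 fun l => h k l
  filter_upwards [h2] with x hx k l hkl
  by_contra hne
  exact hx k l hne hkl

theorem restrict_Ici_pi (p : ℕ) : (volume : Measure (Fin p → ℝ)).restrict (Ici 0) =
    Measure.pi fun _ => (volume : Measure ℝ).restrict (Ioi 0) := by
  have h : Ici (0 : Fin p → ℝ) = univ.pi fun _ => Ici (0 : ℝ) := by
    ext x
    simp [Pi.le_def]
  rw [h, volume_pi, Measure.restrict_pi_pi]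
  simp only [restrict_Ioi_eq_restrict_Ici]

/-- The columns of the determinant coming from `Δ_μ`, with its share of the weight. -/
noncomputable def schurColumn (d m : ℕ) (β : ℝ) (x : ℝ) : ℂ :=
  (x / (1 + x) : ℂ) ^ m * ((x : ℂ) ^ d * (1 + x : ℂ) ^ (-β : ℂ))

theorem sphericalIntegrand_canonicalBasis {p q : ℕ} (hpq : p ≤ q) (α : ℝ) (μ : Fin p → ℕ)
    (s : Fin p → ℂ) {x : Fin p → ℝ} (hx : ∀ k, 0 ≤ x k) (hinj : Function.Injective x) :
    sphericalIntegrand (q := q) (canonicalBasis α μ) s x =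
      (∏ n ∈ Finset.range p, (n.factorial : ℂ) * poch ((q - p : ℕ) + 1) n) /
        diffProd (fun k => s k ^ 2) *
      ((Matrix.of fun k l : Fin p =>
          schurColumn (q - p) (μ l + (p - 1 - (l : ℕ))) (α - p + 1) (x k)).det *
        (Matrix.of fun k j : Fin p => gauss2F1 (((q - p : ℕ) + 1) / 2 + s j)
          (((q - p : ℕ) + 1) / 2 - s j) ((q - p : ℕ) + 1) (-(x k : ℂ))).det) := by
  have hpos (k : Fin p) : 0 < 1 + x k := by linarith [hx k]
  have hcol : (Matrix.of fun k l : Fin p =>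
      schurColumn (q - p) (μ l + (p - 1 - (l : ℕ))) (α - p + 1) (x k)).det =
      (((∏ k, (x k ^ (q - p) * (1 + x k) ^ ((p : ℝ) - 1 - α))) *
        (Matrix.of fun k l : Fin p =>
          (x k / (1 + x k)) ^ (μ l + (p - 1 - (l : ℕ)))).det : ℝ) : ℂ) := by
    rw [← Matrix.det_mul_column, ← Complex.ofRealHom_eq_coe, RingHom.map_det]
    congr 1
    ext k l
    simp only [schurColumn, Matrix.of_apply, RingHom.mapMatrix_apply, Matrix.map_apply,
      Complex.ofRealHom_eq_coe, Complex.ofReal_mul, Complex.ofReal_pow, Complex.ofReal_div,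
      Complex.ofReal_add, Complex.ofReal_one, Complex.ofReal_cpow (hpos k).le]
    push_cast
    rw [show -((α : ℂ) - p + 1) = p - 1 - α by ring]
    ring
  have hdx : diffProd (fun k => (x k : ℂ)) = ((diffProd x : ℝ) : ℂ) := by
    simp [diffProd]
  have hd0 : ((diffProd x : ℝ) : ℂ) ≠ 0 := by exact_mod_cast diffProd_ne_zero hinj
  rw [sphericalIntegrand, canonicalBasis_radialPoint hpq α μ hx hinj, sphericalFun, hcol,
    radialWeight, hdx, Nat.cast_sub hpq, Finset.prod_mul_distrib (s := Finset.univ)]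
  push_cast
  field_simp

/-- Here A plays the role of α-h. Both normalizing factors of the dual Hahn polynomial are (β)_m,
which turns 1/Γ(β)² into 1/Γ(β+m)²; the argument i·s makes its numerator parameters A ∓ s. -/
theorem integral_schurColumn_mul_gauss2F1 (d m : ℕ) {A β : ℝ} {s : ℂ}
    (hAβ : A + ((d : ℝ) + 1) / 2 = β) (hs : |s.re| < A) :
    IntegrableOn (fun x : ℝ => schurColumn d m β x *
      gauss2F1 ((d + 1) / 2 + s) ((d + 1) / 2 - s) (d + 1) (-(x : ℂ))) (Ioi 0) ∧
    ∫ x in Ioi (0 : ℝ), schurColumn d m β x *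
      gauss2F1 ((d + 1) / 2 + s) ((d + 1) / 2 - s) (d + 1) (-(x : ℂ)) =
      (1 / Complex.Gamma (β + m) ^ 2) * ((d.factorial *
        (Complex.Gamma (A + s) * Complex.Gamma (A - s))) *
        dualHahn m (Complex.I * s) A (((d : ℝ) + 1) / 2 : ℝ) (((d : ℝ) + 1) / 2 : ℝ)) := by
  have hs' := abs_lt.1 hs
  have hre : (((d : ℂ) + 1) / 2).re = ((d : ℝ) + 1) / 2 := by
    rw [show ((d : ℂ) + 1) / 2 = (((d : ℝ) + 1) / 2 : ℝ) by push_cast; rfl, Complex.ofReal_re]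
  have hd : (0 : ℝ) ≤ d := d.cast_nonneg
  have hβ : 0 < (β : ℂ).re := by rw [Complex.ofReal_re]; linarith
  obtain ⟨h1, h2⟩ := integral_gauss2F1_mul_pow d m (β := β) (a := (d + 1) / 2 + s)
    (b := (d + 1) / 2 - s) (by ring) (by rw [Complex.add_re, hre]; linarith)
    (by rw [Complex.sub_re, hre]; linarith)
  refine ⟨h1, h2.trans ?_⟩
  have hAβ' : (A : ℂ) + (((d : ℝ) + 1) / 2 : ℝ) = β := by exact_mod_cast hAβ
  have e1 : (β : ℂ) - ((d + 1) / 2 + s) = A - s := by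
    rw [← hAβ']; push_cast; ring
  have e2 : (β : ℂ) - ((d + 1) / 2 - s) = A + s := by
    rw [← hAβ']; push_cast; ring
  have e3 : (A : ℂ) + Complex.I * (Complex.I * s) = A - s := by
    rw [← mul_assoc, Complex.I_mul_I]; ring
  have e4 : (A : ℂ) - Complex.I * (Complex.I * s) = A + s := by
    rw [← mul_assoc, Complex.I_mul_I]; ring
  rw [dualHahn_eq_sum, hAβ', e1, e2, e3, e4, Gamma_add_natCast hβ]
  have := Complex.Gamma_ne_zero_of_re_pos hβ
  have := poch_ne_zero hβ m
  field_simp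

theorem theorem6p14 (p q : ℕ) (hpq : p ≤ q) (α : ℝ) (μ : Fin p → ℕ) (hμ : Antitone μ)
    (r h : ℝ) (hr : r = ((q : ℝ) - p + 1) / 2) (hh : h = ((q : ℝ) + p - 1) / 2)
    (s : Fin p → ℂ) (hs : ∀ k, |(s k).re| < α - h)
    (hdist : ∀ k l, k ≠ l → s k ^ 2 ≠ s l ^ 2) (κ : ℂ) :
    IntegrableOn (sphericalIntegrand (q := q) (canonicalBasis α μ) s) (Ici (0 : Fin p → ℝ)) ∧
    sphericalTransform (q := q) κ (canonicalBasis α μ) s =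
      (κ * p.factorial *
          (∏ j ∈ Finset.range p, ((j.factorial : ℂ) * (q - p + j).factorial)) /
          ∏ j : Fin p, poch ((α : ℂ) - (j : ℕ)) (μ j) ^ 2) *
        ((∏ k, Complex.Gamma (α - h + s k) * Complex.Gamma (α - h - s k)) /
          ∏ j ∈ Finset.range p, Complex.Gamma ((α : ℂ) - j) ^ 2) *
        ((Matrix.of fun k l : Fin p =>
            dualHahn (μ l + (p - 1 - (l : ℕ))) (Complex.I * s k) (α - h) r r).det /
          diffProd (fun k => s k ^ 2)) := by
  have hr' : r = (((q - p : ℕ) : ℝ) + 1) / 2 := by rw [hr, Nat.cast_sub hpq]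
  have hAβ : (α - h) + (((q - p : ℕ) : ℝ) + 1) / 2 = α - p + 1 := by
    rw [hh, Nat.cast_sub hpq]; ring
  have hent (l j : Fin p) := integral_schurColumn_mul_gauss2F1 (q - p)
    (μ l + (p - 1 - (l : ℕ))) hAβ (hs j)
  obtain ⟨hI, hV⟩ := integral_det_mul_det ((volume : Measure ℝ).restrict (Ioi 0))
    (fun l : Fin p => schurColumn (q - p) (μ l + (p - 1 - (l : ℕ))) (α - p + 1))
    (fun (j : Fin p) (x : ℝ) => gauss2F1 (((q - p : ℕ) + 1) / 2 + s j)
      (((q - p : ℕ) + 1) / 2 - s j) ((q - p : ℕ) + 1) (-(x : ℂ))) fun l j => (hent l j).1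
  rw [← restrict_Ici_pi] at hI hV
  have hae := ((ae_restrict_mem (μ := (volume : Measure (Fin p → ℝ)))
    (measurableSet_Ici (a := 0))).and (ae_restrict_of_ae (ae_injective_pi p))).mono fun x hx =>
      sphericalIntegrand_canonicalBasis hpq α μ s (fun k => hx.1 k) hx.2
  refine ⟨(hI.const_mul _).congr (hae.mono fun x hx => hx.symm), ?_⟩
  rw [sphericalTransform, integral_congr_ae hae, integral_const_mul, hV, Fintype.card_fin]
  -- With l counted from 0, β + m = (α-p+1) + (μ_l+p-1-l) = α-l+μ_l. The Gamma factors depend on l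
  -- alone or on s_j alone and leave the determinant.
  have hdet : (Matrix.of fun l j : Fin p => ∫ x in Ioi (0 : ℝ),
      schurColumn (q - p) (μ l + (p - 1 - (l : ℕ))) (α - p + 1) x *
        gauss2F1 (((q - p : ℕ) + 1) / 2 + s j) (((q - p : ℕ) + 1) / 2 - s j)
          ((q - p : ℕ) + 1) (-(x : ℂ))).det =
      (∏ l : Fin p, 1 / (Complex.Gamma ((α : ℂ) - (l : ℕ)) * poch ((α : ℂ) - (l : ℕ)) (μ l)) ^ 2) *
      ((∏ k : Fin p, (((q - p).factorial : ℂ) *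
        (Complex.Gamma (α - h + s k) * Complex.Gamma (α - h - s k)))) *
      (Matrix.of fun k l : Fin p =>
        dualHahn (μ l + (p - 1 - (l : ℕ))) (Complex.I * s k) (α - h) r r).det) := by
    rw [← Matrix.det_mul_column, ← Matrix.det_transpose, ← Matrix.det_mul_row]
    congr 1
    ext j l
    simp only [Matrix.transpose_apply, Matrix.of_apply]
    have hl : (l : ℕ) + 1 ≤ p := l.2
    -- α > h ≥ p - 1/2 > l.
    have hre : 0 < ((α : ℂ) - (l : ℕ)).re := by
      have h1 : ((l : ℕ) : ℝ) + 1 ≤ p := by exact_mod_cast hl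
      have h2 : (p : ℝ) ≤ q := by exact_mod_cast hpq
      have h3 := (abs_nonneg _).trans_lt (hs l)
      simp only [Complex.sub_re, Complex.ofReal_re, Complex.natCast_re]
      linarith
    rw [(hent l j).2, ← Gamma_add_natCast hre, ← hr']
    congr 3
    · congr 1
      have : ((p - 1 - (l : ℕ) : ℕ) : ℂ) = p - 1 - (l : ℕ) := by
        rw [Nat.sub_sub, Nat.cast_sub (by omega)]; push_cast; ring
      push_cast [this]
      ring
    all_goals push_cast; rfl
  -- Each of the p columns in s_j contributes a factor (q-p)!, which completes (q-p+1)_n to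
  -- (q-p+n)!.
  have hK : (∏ n ∈ Finset.range p, (n.factorial : ℂ) * poch ((q - p : ℕ) + 1) n) *
      ((q - p).factorial : ℂ) ^ p =
      ∏ j ∈ Finset.range p, ((j.factorial : ℂ) * (q - p + j).factorial) := by
    rw [← Finset.card_range p, ← Finset.prod_const, Finset.card_range, ← Finset.prod_mul_distrib]
    refine Finset.prod_congr rfl fun n _ => ?_
    rw [natCast_factorial_add]
    ring
  rw [hdet, ← hK, Finset.prod_mul_distrib (f := fun _ : Fin p => ((q - p).factorial : ℂ)),
    Finset.prod_const, Finset.card_univ, Fintype.card_fin, Finset.prod_div_distrib,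
    ← Fin.prod_univ_eq_prod_range (fun j => Complex.Gamma ((α : ℂ) - j) ^ 2)]
  simp only [mul_pow, Finset.prod_mul_distrib, Finset.prod_const_one, div_eq_mul_inv, mul_inv]
  ring
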